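/- **Model.** Let $\mathbb P$ be a finite set of processes with a distinguished source $s$, joined by a directed network of channels (each from a process to another process), and let $f\ge 0$. Time is discrete and synchronous: a message sent at time $t$ arrives at time $t+1$. In a run at most $f$ processes crash; a process crashing at time $\tau$ behaves correctly before $\tau$, at time $\tau$ sends only a subset of the messages its protocol prescribes and performs no action, and is inactive afterwards. If it fails to send to $p$ at its crash, the channel to $p$ is *blocked* from time $\tau$ on. The source has an initial value $v_s\in\{0,1\}$, all other initial values are fixed, and a protocol is deterministic: the messages sent (over channels, from an alphabet with at least two elements) and the actions performed are functions of the local state, which consists of the initial value, the time, and all events observed so far (messages sent and received, actions performed). The *nice run* $\hat r(Q)$ of a protocol $Q$ is its run with $v_s=1$ and no crash. Process $i$ *knows* a fact at time $t$ of a run $r$ of $Q$ if the fact holds at time $t$ of every run of $Q$ in which $i$ has the same local state at time $t$ as in $r$. **Communication graphs.** Process $i$ *sends $j$ a null message* at time $t$ of a run $r$ of $Q$ if the channel from $i$ to $j$ is not blocked at that time, $i$ does not send an actual message to $j$ at time $t$ of $r$, and it does so at time $t$ of some run of $Q$. The graph $\mathsf{nG}(Q)$ has nodes $\langle p,t\rangle$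 ($p\in\mathbb P$, $t\in\mathbb N$), the local edges $\langle i,t\rangle\to\langle i,t+1\rangle$, and an edge $\langle i,t\rangle\to\langle j,t+1\rangle$ in $E_{\sf a}$ (respectively $E_{\sf n}$) whenever $i$ sends $j$ an actual (respectively null) message at time $t$ of $\hat r(Q)$. For $B\subseteq\mathbb P$, a path is $B_{\not n}$ if it contains no null message edge sent by a process in $B$; paths of length $0$ are allowed. For an integer $n\ge -1$, an *$n$-resilient message block* between $\theta$ and $\theta'$ is a set $\Gamma$ of paths from $\theta$ to $\theta'$ such that for every $B\subseteq\mathbb P$ with $|B|\le n$ some path in $\Gamma$ is $B_{\not n}$ (for $n=-1$ the requirement on the sets $B$ is void). **Ordered Response.** Let $a_1,\dots,a_k$ be actions, $a_h$ belonging to process $i_h$. A protocol *solves* $\mathsf{OR}=\langle v_s=1,a_1,\dots,a_k\rangle$ *with respect to times* $t_1\le\dots\le t_k$ if in every run each $a_h$ is performed only if $v_s=1$ and $a_1,\dots,a_{h-1}$ are performed, the performed actions occur in order (no $a_j$ with $j<h$ is performed later than $a_h$), and in its nice run each $a_h$ is performed exactly at time $t_h$. It is *conservative* if in every run each $i_h$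 performs $a_h$ at $t_h$ only if $i_h$ does not then know that the current run is not the nice run. **Theorem (Sufficient conditions for O-R).** Let $t_1\le\dots\le t_k$, and put $\theta_s=\langle s,0\rangle$, $\theta_h=\langle i_h,t_h\rangle$, $\theta_h^+=\langle i_h,t_h+1\rangle$. Let $\mathsf{CG}$ be the communication graph of the nice run of some protocol (which need not solve $\mathsf{OR}$), and suppose that in $\mathsf{CG}$ 1. for every $h\le k$ there is an $f$-resilient message block between $\theta_s$ and $\theta_h$; 2. for every $h<k$ there is an $(f-1)$-resilient message block between $\theta_h^+$ and $\theta_{h+1}$ none of whose paths contains a null message sent by $i_h$; 3. for all nodes $\rho_b=\langle b,m_b\rangle$, indices $x<h\le k$ and sets $B\subseteq\mathbb P$ with $b\in B$ and $|B|\le f$: if there is a path from $\rho_b$ to $\theta_x$ that starts with an edge in $E_{\sf a}$ and contains no null message sent by $b$, and there is no $B_{\not n}$ path from $\theta_x$ to $\theta_h$, then there is a $B_{\not n}$ path from $\langle b,m_b+1\rangle$ to $\theta_h$. Then there is a protocol $Q$ with $\mathsf{nG}(Q)=\mathsf{CG}$ that solves $\mathsf{OR}$ with respect to the times $t_1\le\dots\le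 t_k$; moreover, $Q$ can be chosen conservative. -/

import Mathlib

/-! Synchronous message passing with crash failures, null messages, communication graphs,
resilient message blocks, and the Ordered Response problem. -/

namespace OrderedResponse

/-- The parameters of the synchronous model: a directed network on the set `P` of processes (an
edge is a channel to another process), the source, and the bound `f` on the number of crashes. -/
structure Model (P : Type*) where
  source : P
  chan : P → P → Prop
  chan_irrefl : ∀ i, ¬ chan i i
  f : ℕ

/-- What an active process observes in one round: the messages it sends (by addressee), the actions
it performs, and the messages it receives (by sender). -/
structure RoundEvents (P M : Type*) (k : ℕ) where
  sent : P → Option M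
  performed : Set (Fin k)
  received : P → Option M

/-- A local state: the initial value, the current time, and the sequence of observed events. -/
structure LocalState (P M : Type*) (k : ℕ) where
  initVal : Bool
  time : ℕ
  events : List (RoundEvents P M k)

/-- A deterministic protocol with messages in `M`. `msg i σ j` is the message (if any) that `i` has
to send to `j` in local state `σ`, and `act h σ` says that the process responsible for the
action `a_h` has to perform it in local state `σ`. Messages are sent over channels only. -/
structure Protocol {P : Type*} (S : Model P) (M : Type*) (k : ℕ) where
  msg : P → LocalState P M k → P → Option M
  act : Fin k → LocalState P M k → Prop
  msg_chan : ∀ i σ j, msg i σ j ≠ none → S.chan i j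

/-- The data that determine a run of a given protocol: the initial value of the source (`true` is
`1`) and a failure pattern with at most `f` failing processes. `fails q = some (τ, Bl)` means that
`q` crashes at time `τ` and that its messages of round `τ + 1` to the members of `Bl` are
not sent. -/
structure Run {P : Type*} [Fintype P] (S : Model P) where
  vs : Bool
  fails : P → Option (ℕ × Finset P)
  card_le : (Finset.univ.filter fun p => (fails p).isSome = true).card ≤ S.f

section Semantics

variable {P M : Type*} [Fintype P] [DecidableEq P] {S : Model P} {k : ℕ}

/-- `i` has not failed up to and including time `t`. -/
def Run.Active (r : Run S) (i : P) (t : ℕ) : Prop :=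
  ∀ τ Bl, r.fails i = some (τ, Bl) → t < τ

/-- The message (if any) that is sent from `i` to `j` at time `t`, where `σ` is the local state
of `i` at time `t`. -/
def Protocol.sentFrom (Q : Protocol S M k) (r : Run S) (t : ℕ) (i : P) (σ : LocalState P M k)
    (j : P) : Option M :=
  match r.fails i with
  | none => Q.msg i σ j
  | some (τ, Bl) =>
      if t < τ then Q.msg i σ j
      else if t = τ then (if j ∈ Bl then none else Q.msg i σ j)
      else none

open Classical in
/-- The local state of every process at every time of the run `r` of `Q`, where `proc h` is the
process responsible for `a_h`. Only the initial value of the source varies. A process that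
has crashed observes nothing any more. -/
noncomputable def Protocol.state (Q : Protocol S M k) (proc : Fin k → P) (r : Run S) :
    ℕ → P → LocalState P M k
  | 0 => fun i => ⟨if i = S.source then r.vs else false, 0, []⟩
  | t + 1 => fun i =>
      let σ := Q.state proc r t
      if r.Active i t then
        ⟨(σ i).initVal, t + 1, (σ i).events ++
          [⟨fun j => Q.msg i (σ i) j, {h | proc h = i ∧ Q.act h (σ i)},
            fun j => Q.sentFrom r t j (σ j) i⟩]⟩
      else ⟨(σ i).initVal, t + 1, (σ i).events⟩

/-- `i` sends an actual message to `j` at `(r, t)`. -/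
def Protocol.SendsActual (Q : Protocol S M k) (proc : Fin k → P) (r : Run S) (t : ℕ)
    (i j : P) : Prop :=
  ∃ m : M, Q.sentFrom r t i (Q.state proc r t i) j = some m

/-- The channel from `i` to `j` is blocked at `(r, t)`. -/
def Run.Blocked (r : Run S) (t : ℕ) (i j : P) : Prop :=
  ∃ τ Bl, r.fails i = some (τ, Bl) ∧ j ∈ Bl ∧ τ ≤ t

/-- `i` sends a null message to `j` at `(r, t)`. -/
def Protocol.SendsNull (Q : Protocol S M k) (proc : Fin k → P) (r : Run S) (t : ℕ)
    (i j : P) : Prop :=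
  ¬ r.Blocked t i j ∧ ¬ Q.SendsActual proc r t i j ∧ ∃ r' : Run S, Q.SendsActual proc r' t i j

/-- The action `a_h` is performed at time `t` of the run `r`. -/
def Protocol.Performs (Q : Protocol S M k) (proc : Fin k → P) (r : Run S) (h : Fin k)
    (t : ℕ) : Prop :=
  r.Active (proc h) t ∧ Q.act h (Q.state proc r t (proc h))

/-- The nice run: `v_s = 1` and nobody fails. -/
def niceRun (S : Model P) : Run S where
  vs := true
  fails := fun _ => none
  card_le := by simp

/-- Knowledge: `i` knows the fact `φ` at time `t` of the run `r` of `Q`. -/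
def Protocol.Knows (Q : Protocol S M k) (proc : Fin k → P) (i : P) (φ : Run S → ℕ → Prop)
    (r : Run S) (t : ℕ) : Prop :=
  ∀ r' : Run S, Q.state proc r' t i = Q.state proc r t i → φ r' t

end Semantics

/-- A communication graph on the process-time nodes `(p, t)`, given by its actual message edges and
its null message edges. The local edges are the same in all such graphs. -/
@[ext]
structure CommGraph (P : Type*) where
  actual : Set ((P × ℕ) × (P × ℕ))
  null : Set ((P × ℕ) × (P × ℕ))

namespace CommGraph

variable {P : Type*} (G : CommGraph P)

/-- Edges: local edges, actual message edges, null message edges. -/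
def Edge (a b : P × ℕ) : Prop :=
  b = (a.1, a.2 + 1) ∨ (a, b) ∈ G.actual ∨ (a, b) ∈ G.null

/-- `π` is (the sequence of nodes of) a path from `a` to `b`. -/
def IsPath (a b : P × ℕ) (π : List (P × ℕ)) : Prop :=
  π.head? = some a ∧ π.getLast? = some b ∧ π.IsChain G.Edge

/-- `π` contains no null messages sent by members of `B`. -/
def NullFree (B : Finset P) (π : List (P × ℕ)) : Prop :=
  ∀ e ∈ π.zip π.tail, e ∈ G.null → e.1.1 ∉ B

/-- There is a path from `a` to `b` without null messages from `B`. -/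
def HasNullFreePath (B : Finset P) (a b : P × ℕ) : Prop :=
  ∃ π, G.IsPath a b π ∧ G.NullFree B π

/-- The set `Γ` of paths is an `n`-resilient message block from `a` to `b`. (The integer `n` may
be `-1`, in which case there is no set `B` to consider.) -/
def IsResilientBlock (n : ℤ) (a b : P × ℕ) (Γ : Set (List (P × ℕ))) : Prop :=
  (∀ π ∈ Γ, G.IsPath a b π) ∧
    ∀ B : Finset P, (B.card : ℤ) ≤ n → ∃ π ∈ Γ, G.NullFree B π

end CommGraph

section Problem

variable {P M : Type*} [Fintype P] [DecidableEq P] {S : Model P} {k : ℕ}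

/-- The communication graph of the run `r` of `Q`. -/
def Protocol.commGraph (Q : Protocol S M k) (proc : Fin k → P) (r : Run S) : CommGraph P where
  actual := {e | ∃ i j t, e = ((i, t), (j, t + 1)) ∧ Q.SendsActual proc r t i j}
  null := {e | ∃ i j t, e = ((i, t), (j, t + 1)) ∧ Q.SendsNull proc r t i j}

/-- The communication graph of the nice run of `Q`. -/
def Protocol.niceGraph (Q : Protocol S M k) (proc : Fin k → P) : CommGraph P :=
  Q.commGraph proc (niceRun S)

/-- Consistency with Ordered Response: in every run, `a_h` is performed only if `v_s = 1` and all
earlier actions are performed too, and the actions that are performed are performed in order. -/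
def Protocol.Consistent (Q : Protocol S M k) (proc : Fin k → P) : Prop :=
  ∀ r : Run S, ∀ h : Fin k, ∀ t : ℕ, Q.Performs proc r h t →
    r.vs = true ∧
    ∀ j < h, (∃ t', Q.Performs proc r j t') ∧ ∀ t', Q.Performs proc r j t' → t' ≤ t

/-- `Q` solves Ordered Response with respect to the times `t_h`: it is consistent, and in its
nice run each `a_h` is performed, exactly at time `t_h`. -/
def Protocol.SolvesAt (Q : Protocol S M k) (proc : Fin k → P) (t : Fin k → ℕ) : Prop :=
  Q.Consistent proc ∧ ∀ h m, Q.Performs proc (niceRun S) h m ↔ m = t h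

/-- `Q` is conservative: an action is performed at its time only if the acting process does not
know that the current run is not the nice run. -/
def Protocol.Conservative (Q : Protocol S M k) (proc : Fin k → P) (t : Fin k → ℕ) : Prop :=
  ∀ (r : Run S) (h : Fin k), Q.Performs proc r h (t h) →
    ¬ Q.Knows proc (proc h) (fun r' _ => r' ≠ niceRun S) r (t h)

end Problem

end OrderedResponse

/-! Let every process follow the actual edges of `CG` while its local state is the one it has in the
nice run ("nice"), and send along its null edges once it is not; let `a_h` be performed exactly when
the state at `t h` is nice. Silence on a null edge then says "all is nice so far", unless its sender
has failed.

Two propagation facts carry the proof. Forward (`not_niceAt_of_reflTransGen`): deviation from nice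
spreads along every path without null messages from faulty processes. Backward
(`Protocol.exists_path_of_not_niceAt`, valid for every protocol): a deviation at a process that has
not crashed before stems either from `v_s = 0` or from an actual message missing because some `b`
crashed, followed by a path without null messages from `b`.

Suppose `a_h` is performed, so that its node is nice. Condition 1 and the forward fact give `v_s =
1`. Condition 2 shows that the previous actor is still active at its time. Were its state not nice,
the backward fact would produce a crashed `b` as in condition 3; with `B` the set of all faulty
processes, either path offered there carries a deviation to the later node, a contradiction.
Downward induction yields all earlier actions.

That the protocol has graph `CG` uses both facts too: a null edge comes from a message of `Q₀`, the
backward fact for `Q₀` explains that message by one cause, and a run with this cause alone raises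
the alarm in the new protocol. -/

namespace OrderedResponse

open Relation

/-! ### Null-free paths as reflexive transitive closures. -/

namespace CommGraph

variable {P : Type*} (G : CommGraph P)

/-- An edge that is not a null message sent by a member of `B`. -/
def FreeEdge (B : Finset P) (a b : P × ℕ) : Prop :=
  G.Edge a b ∧ ((a, b) ∈ G.null → a.1 ∉ B)

variable {G}

theorem nullFree_cons_cons {B : Finset P} {a b : P × ℕ} {l : List (P × ℕ)} :
    G.NullFree B (a :: b :: l) ↔ ((a, b) ∈ G.null → a.1 ∉ B) ∧ G.NullFree B (b :: l) := by
  simp [NullFree]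

theorem isChain_freeEdge_iff {B : Finset P} {π : List (P × ℕ)} :
    π.IsChain (G.FreeEdge B) ↔ π.IsChain G.Edge ∧ G.NullFree B π := by
  induction π with
  | nil => simp [NullFree]
  | cons a l ih =>
    cases l with
    | nil => simp [NullFree]
    | cons b l =>
      rw [List.isChain_cons_cons, List.isChain_cons_cons, ih, nullFree_cons_cons, FreeEdge]
      tauto

theorem reflTransGen_of_isPath {B : Finset P} {a b : P × ℕ} {π : List (P × ℕ)}
    (hπ : G.IsPath a b π) (hB : G.NullFree B π) : ReflTransGen (G.FreeEdge B) a b := by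
  obtain ⟨h1, h2, h3⟩ := hπ
  cases π with
  | nil => simp at h1
  | cons c l =>
    obtain rfl : c = a := by simpa using h1
    have hc := isChain_freeEdge_iff.2 ⟨h3, hB⟩
    refine List.relationReflTransGen_of_exists_isChain_cons l hc ?_
    rw [List.getLast?_eq_some_getLast (List.cons_ne_nil _ _)] at h2
    exact Option.some.inj h2

theorem exists_isPath_cons {B : Finset P} {a b : P × ℕ}
    (h : ReflTransGen (G.FreeEdge B) a b) :
    ∃ l, G.IsPath a b (a :: l) ∧ G.NullFree B (a :: l) := by
  obtain ⟨l, hl, hb⟩ := List.exists_isChain_cons_of_relationReflTransGen h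
  obtain ⟨h1, h2⟩ := isChain_freeEdge_iff.1 hl
  refine ⟨l, ⟨rfl, ?_, h1⟩, h2⟩
  rw [List.getLast?_eq_some_getLast (List.cons_ne_nil _ _), hb]

theorem hasNullFreePath_iff {B : Finset P} {a b : P × ℕ} :
    G.HasNullFreePath B a b ↔ ReflTransGen (G.FreeEdge B) a b := by
  constructor
  · rintro ⟨π, h1, h2⟩
    exact reflTransGen_of_isPath h1 h2
  · intro h
    obtain ⟨l, h1, h2⟩ := exists_isPath_cons h
    exact ⟨_, h1, h2⟩

end CommGraph

/-! ### Deviation from the nice run, for an arbitrary protocol. -/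

section General

variable {P M : Type*} [Fintype P] [DecidableEq P] {S : Model P} {k : ℕ}

/-- `q` has crashed before time `w`. -/
def Run.CrashedBefore (r : Run S) (q : P) (w : ℕ) : Prop :=
  ∃ τ Bl, r.fails q = some (τ, Bl) ∧ τ < w

theorem Run.not_active_iff {r : Run S} {q : P} {w : ℕ} :
    ¬ r.Active q w ↔ r.CrashedBefore q (w + 1) := by
  simp [Run.Active, Run.CrashedBefore]

/-- The local state of `q` at time `w` of `r` is the same as in the nice run. -/
def Protocol.NiceAt (Q : Protocol S M k) (proc : Fin k → P) (r : Run S) (w : ℕ) (q : P) : Prop :=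
  Q.state proc r w q = Q.state proc (niceRun S) w q

variable {Q : Protocol S M k} {proc : Fin k → P} {r : Run S}

theorem active_niceRun (q : P) (w : ℕ) : (niceRun S).Active q w := by
  simp [Run.Active, niceRun]

theorem Protocol.sentFrom_of_active {i : P} {w : ℕ} (h : r.Active i w)
    (σ : LocalState P M k) (j : P) : Q.sentFrom r w i σ j = Q.msg i σ j := by
  unfold Protocol.sentFrom
  split
  · rfl
  · next τ Bl hf => rw [if_pos (h τ Bl hf)]

theorem Protocol.sentFrom_eq_none_or (r : Run S) (w : ℕ) (i : P)
    (σ : LocalState P M k) (j : P) :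
    Q.sentFrom r w i σ j = none ∨ Q.sentFrom r w i σ j = Q.msg i σ j := by
  unfold Protocol.sentFrom
  split
  · exact Or.inr rfl
  · split_ifs <;> simp

theorem Protocol.sentFrom_of_crashedBefore {i : P} {w : ℕ} (h : r.CrashedBefore i w)
    (σ : LocalState P M k) (j : P) : Q.sentFrom r w i σ j = none := by
  obtain ⟨τ, Bl, hf, hlt⟩ := h
  simp only [Protocol.sentFrom, hf]
  rw [if_neg (by omega), if_neg (by omega)]

theorem Protocol.chan_of_sendsActual {w : ℕ} {i j : P}
    (h : Q.SendsActual proc r w i j) : S.chan i j := by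
  obtain ⟨m, hm⟩ := h
  rcases Q.sentFrom_eq_none_or r w i (Q.state proc r w i) j with h0 | h0
  · rw [h0] at hm; cases hm
  · exact Q.msg_chan i (Q.state proc r w i) j (by rw [← h0, hm]; simp)

theorem Protocol.state_time (w : ℕ) (q : P) : (Q.state proc r w q).time = w := by
  cases w with
  | zero => rfl
  | succ w => simp only [Protocol.state]; split_ifs <;> rfl

theorem Protocol.state_succ_of_active {w : ℕ} {q : P} (h : r.Active q w) :
    Q.state proc r (w + 1) q = ⟨(Q.state proc r w q).initVal, w + 1,
      (Q.state proc r w q).events ++ [⟨fun j => Q.msg q (Q.state proc r w q) j,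
        {h | proc h = q ∧ Q.act h (Q.state proc r w q)},
        fun j => Q.sentFrom r w j (Q.state proc r w j) q⟩]⟩ := by
  simp only [Protocol.state, if_pos h]

theorem Protocol.state_succ_of_not_active {w : ℕ} {q : P} (h : ¬ r.Active q w) :
    Q.state proc r (w + 1) q = ⟨(Q.state proc r w q).initVal, w + 1,
      (Q.state proc r w q).events⟩ := by
  simp only [Protocol.state, if_neg h]

theorem Protocol.length_events_le (w : ℕ) (q : P) :
    (Q.state proc r w q).events.length ≤ w := by
  induction w with
  | zero => simp [Protocol.state]
  | succ w ih =>
    by_cases h : r.Active q w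
    · simpa [state_succ_of_active h] using ih
    · rw [state_succ_of_not_active h]; exact ih.trans (Nat.le_succ w)

theorem Protocol.length_events_niceRun (w : ℕ) (q : P) :
    (Q.state proc (niceRun S) w q).events.length = w := by
  induction w with
  | zero => simp [Protocol.state]
  | succ w ih => simpa [state_succ_of_active (active_niceRun q w)] using ih

/-- States keep their whole history, and equal states prescribe equal messages and actions, so only
receptions can create a new difference for an active process. -/
theorem Protocol.niceAt_succ_iff {w : ℕ} {q : P} :
    Q.NiceAt proc r (w + 1) q ↔ Q.NiceAt proc r w q ∧ r.Active q w ∧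
      ∀ p, Q.sentFrom r w p (Q.state proc r w p) q =
        Q.sentFrom (niceRun S) w p (Q.state proc (niceRun S) w p) q := by
  unfold Protocol.NiceAt
  by_cases h : r.Active q w
  · rw [state_succ_of_active h, state_succ_of_active (active_niceRun q w)]
    constructor
    · intro e
      simp only [LocalState.mk.injEq, true_and] at e
      obtain ⟨e1, e2⟩ := e
      obtain ⟨e2, e3⟩ := List.append_inj' e2 rfl
      simp only [List.cons.injEq, RoundEvents.mk.injEq, and_true] at e3
      refine ⟨?_, h, fun p => congrFun e3.2.2 p⟩
      have ht : (Q.state proc r w q).time = (Q.state proc (niceRun S) w q).time := by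
        rw [state_time, state_time]
      cases hs : Q.state proc r w q
      cases hs' : Q.state proc (niceRun S) w q
      simp_all
    · rintro ⟨e1, -, e2⟩
      simp only [e1, e2]
  -- An inactive round leaves no entry, so the history is too short ever to be nice again.
  · refine iff_of_false (fun e => ?_) (fun e => h e.2.1)
    have h1 := congrArg (fun σ => σ.events.length) e
    simp only [length_events_niceRun, state_succ_of_not_active h] at h1
    have : (Q.state proc r w q).events.length ≤ w := Q.length_events_le w q
    omega

theorem Protocol.not_niceAt_of_crashedBefore {w : ℕ} {q : P} (h : r.CrashedBefore q w) :
    ¬ Q.NiceAt proc r w q := by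
  cases w with
  | zero => obtain ⟨τ, Bl, -, h⟩ := h; omega
  | succ w => rw [niceAt_succ_iff]; exact fun e => Run.not_active_iff.2 h e.2.1

theorem Protocol.niceGraph_actual_iff {i j : P} {w : ℕ} :
    ((i, w), (j, w + 1)) ∈ (Q.niceGraph proc).actual ↔ Q.SendsActual proc (niceRun S) w i j := by
  constructor
  · rintro ⟨i', j', t', e, h⟩
    simp only [Prod.mk.injEq] at e
    obtain ⟨⟨rfl, rfl⟩, rfl, -⟩ := e
    exact h
  · exact fun h => ⟨i, j, w, rfl, h⟩

theorem Protocol.niceGraph_null_iff {i j : P} {w : ℕ} :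
    ((i, w), (j, w + 1)) ∈ (Q.niceGraph proc).null ↔
      ¬ Q.SendsActual proc (niceRun S) w i j ∧ ∃ r', Q.SendsActual proc r' w i j := by
  have hb : ¬ (niceRun S).Blocked w i j := by simp [Run.Blocked, niceRun]
  constructor
  · rintro ⟨i', j', t', e, h⟩
    simp only [Prod.mk.injEq] at e
    obtain ⟨⟨rfl, rfl⟩, rfl, -⟩ := e
    exact h.2
  · exact fun h => ⟨i, j, w, rfl, hb, h⟩

theorem Protocol.chan_of_mem_niceGraph {i j : P} {w : ℕ}
    (h : ((i, w), (j, w + 1)) ∈ (Q.niceGraph proc).actual ∨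
      ((i, w), (j, w + 1)) ∈ (Q.niceGraph proc).null) : S.chan i j := by
  rw [niceGraph_actual_iff, niceGraph_null_iff] at h
  rcases h with h | ⟨-, r', h⟩ <;> exact chan_of_sendsActual h

theorem Protocol.freeEdge_local (B : Finset P) (q : P) (w : ℕ) :
    (Q.niceGraph proc).FreeEdge B (q, w) (q, w + 1) :=
  ⟨Or.inl rfl, fun h => (S.chan_irrefl q (chan_of_mem_niceGraph (Or.inr h))).elim⟩

/-- In the graph of a run, actual and null edges are disjoint. -/
theorem Protocol.freeEdge_of_actual (B : Finset P) {p q : P} {w : ℕ}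
    (h : ((p, w), (q, w + 1)) ∈ (Q.niceGraph proc).actual) :
    (Q.niceGraph proc).FreeEdge B (p, w) (q, w + 1) :=
  ⟨Or.inr (Or.inl h), fun h' => ((niceGraph_null_iff.1 h').1 (niceGraph_actual_iff.1 h)).elim⟩

/-- If the local state of `q` at time `w` differs from the nice one and `q` has not crashed before,
then a change of the initial value or a crash is noticed there through the edges of the
communication graph of the nice run. -/
theorem Protocol.exists_path_of_not_niceAt {w : ℕ} {q : P} (hn : ¬ Q.NiceAt proc r w q)
    (hq : ¬ r.CrashedBefore q w) :
    (r.vs = false ∧ ReflTransGen ((Q.niceGraph proc).FreeEdge ∅) (S.source, 0) (q, w)) ∨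
    ∃ b u, r.CrashedBefore b (u + 1) ∧ u < w ∧
      ∃ p, ((b, u), (p, u + 1)) ∈ (Q.niceGraph proc).actual ∧
        ReflTransGen ((Q.niceGraph proc).FreeEdge {b}) (p, u + 1) (q, w) := by
  induction w generalizing q with
  | zero =>
    left
    by_cases hs : q = S.source
    · subst hs
      refine ⟨?_, ReflTransGen.refl⟩
      by_contra h
      exact hn (by simp [Protocol.NiceAt, Protocol.state, niceRun, h])
    · exact (hn (by simp [Protocol.NiceAt, Protocol.state, hs])).elim
  | succ w ih =>
    -- An explanation for the predecessor `(p, w)` extends over its edge to `(q, w + 1)`. The edge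
    -- must be free for `∅` in the first case, and for `{b}` in the second, where `b` has crashed
    -- before `w`.
    have extend : ∀ {p}, ¬ Q.NiceAt proc r w p → ¬ r.CrashedBefore p w →
        (∀ b u, r.CrashedBefore b (u + 1) → u < w →
          (Q.niceGraph proc).FreeEdge {b} (p, w) (q, w + 1)) →
        (Q.niceGraph proc).FreeEdge ∅ (p, w) (q, w + 1) →
        (r.vs = false ∧ ReflTransGen ((Q.niceGraph proc).FreeEdge ∅) (S.source, 0) (q, w + 1)) ∨
        ∃ b u, r.CrashedBefore b (u + 1) ∧ u < w + 1 ∧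
          ∃ p, ((b, u), (p, u + 1)) ∈ (Q.niceGraph proc).actual ∧
            ReflTransGen ((Q.niceGraph proc).FreeEdge {b}) (p, u + 1) (q, w + 1) := by
      intro p hp hc he he0
      rcases ih hp hc with ⟨h1, h2⟩ | ⟨b, u, h1, h2, c, h3, h4⟩
      · exact Or.inl ⟨h1, h2.tail he0⟩
      · exact Or.inr ⟨b, u, h1, by omega, c, h3, h4.tail (he b u h1 h2)⟩
    have hact : r.Active q w := by
      by_contra h; exact hq (Run.not_active_iff.1 h)
    by_cases hqw : Q.NiceAt proc r w q
    · rw [niceAt_succ_iff] at hn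
      push Not at hn
      obtain ⟨p, hp⟩ := hn hqw hact
      by_cases ha : ((p, w), (q, w + 1)) ∈ (Q.niceGraph proc).actual
      · by_cases hpa : r.Active p w
        · refine extend (p := p) (fun e => hp ?_) (fun hc => ?_)
            (fun b u _ _ => freeEdge_of_actual _ ha) (freeEdge_of_actual _ ha)
          · rw [sentFrom_of_active hpa, sentFrom_of_active (active_niceRun p w), e]
          · obtain ⟨τ, Bl, h1, h2⟩ := hc
            have := hpa τ Bl h1
            omega
        -- The expected message comes from a crashed process: the trace ends here.
        · exact Or.inr ⟨p, w, Run.not_active_iff.1 hpa, by omega, q, ha, ReflTransGen.refl⟩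
      · have hnone : Q.sentFrom (niceRun S) w p (Q.state proc (niceRun S) w p) q = none := by
          by_contra h
          obtain ⟨m, hm⟩ := Option.ne_none_iff_exists'.1 h
          exact ha (niceGraph_actual_iff.2 ⟨m, hm⟩)
        rw [hnone] at hp
        obtain ⟨m, hm⟩ := Option.ne_none_iff_exists'.1 hp
        -- An unexpected message in `r` is itself the witness that the silence of the nice run is a
        -- null message.
        have hnull : ((p, w), (q, w + 1)) ∈ (Q.niceGraph proc).null :=
          niceGraph_null_iff.2 ⟨fun h => ha (niceGraph_actual_iff.2 h), r, m, hm⟩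
        have hpc : ¬ r.CrashedBefore p w := fun h => hp (sentFrom_of_crashedBefore h _ _)
        refine extend (p := p) (fun e => ?_) hpc (fun b u hb hu => ⟨Or.inr (Or.inr hnull), ?_⟩)
          ⟨Or.inr (Or.inr hnull), by simp⟩
        · rw [sentFrom_of_active (active_niceRun p w), ← e] at hnone
          rcases Q.sentFrom_eq_none_or r w p (Q.state proc r w p) q with h | h
          · exact hp h
          · exact hp (h.trans hnone)
        -- The sender `p` has just sent something at `w`, whereas `b` crashed before `w`; hence `p ≠
        -- b`.
        · rintro - hpb
          obtain rfl : p = b := by simpa using hpb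
          obtain ⟨τ, Bl, h1, h2⟩ := hb
          exact hpc ⟨τ, Bl, h1, by omega⟩
    · refine extend hqw (fun hc => ?_) (fun b u _ _ => freeEdge_local _ _ _) (freeEdge_local _ _ _)
      obtain ⟨τ, Bl, h1, h2⟩ := hc
      exact hq ⟨τ, Bl, h1, by omega⟩

end General

/-! ### The alarm protocol and the spread of deviations. -/

section Construction

variable {P M : Type*} [Fintype P] [DecidableEq P] {S : Model P} {k : ℕ}

open Classical in
/-- The local states in a nice run in which exactly the edges in `G.actual` carry messages, all
equal to `m₀`, and each `a_h` is performed at time `t h`. -/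
noncomputable def niceState (S : Model P) (G : CommGraph P) (proc : Fin k → P) (t : Fin k → ℕ)
    (m₀ : M) (i : P) (u : ℕ) : LocalState P M k :=
  ⟨if i = S.source then true else false, u, (List.range u).map fun w =>
    ⟨fun j => if ((i, w), (j, w + 1)) ∈ G.actual then some m₀ else none,
      {h | proc h = i ∧ t h = w},
      fun j => if ((j, w), (i, w + 1)) ∈ G.actual then some m₀ else none⟩⟩

open Classical in
/-- The protocol that sends along the actual edges of `G` and acts as required as long as the local
state is nice, and sends along the null edges of `G` instead once it is not. -/
noncomputable def alarmProtocol (S : Model P) (G : CommGraph P) (proc : Fin k → P)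
    (t : Fin k → ℕ) (m₀ : M)
    (hG : ∀ {i j : P} {w : ℕ}, ((i, w), (j, w + 1)) ∈ G.actual ∨ ((i, w), (j, w + 1)) ∈ G.null →
      S.chan i j) : Protocol S M k where
  msg i σ j :=
    if σ = niceState S G proc t m₀ i σ.time then
      (if ((i, σ.time), (j, σ.time + 1)) ∈ G.actual then some m₀ else none)
    else (if ((i, σ.time), (j, σ.time + 1)) ∈ G.null then some m₀ else none)
  act h σ := σ = niceState S G proc t m₀ (proc h) (t h)
  msg_chan i σ j h := by
    split_ifs at h with _ h1 h2
    · exact hG (Or.inl h1)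
    · exact absurd rfl h
    · exact hG (Or.inr h2)
    · exact absurd rfl h

variable {G : CommGraph P} {proc : Fin k → P} {t : Fin k → ℕ} {m₀ : M}
  {hG : ∀ {i j : P} {w : ℕ}, ((i, w), (j, w + 1)) ∈ G.actual ∨ ((i, w), (j, w + 1)) ∈ G.null →
      S.chan i j}

/-- Defining the protocol through its own nice run would be circular; it is defined through a closed
form instead, which is justified here. -/
theorem state_niceRun_alarmProtocol (i : P) (u : ℕ) :
    (alarmProtocol S G proc t m₀ hG).state proc (niceRun S) u i =
      niceState S G proc t m₀ i u := by
  induction u generalizing i with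
  | zero => simp [Protocol.state, niceState, niceRun]
  | succ u ih =>
    rw [Protocol.state_succ_of_active (active_niceRun i u)]
    simp only [ih, Protocol.sentFrom_of_active (active_niceRun _ u)]
    have hact : {h | proc h = i ∧
        (alarmProtocol S G proc t m₀ hG).act h (niceState S G proc t m₀ i u)} =
        {h | proc h = i ∧ t h = u} := by
      ext h
      refine and_congr_right fun hi => ?_
      subst hi
      exact ⟨fun e => (congrArg LocalState.time e).symm, fun e => by subst e; rfl⟩
    rw [hact]
    simp [alarmProtocol, niceState, List.range_succ]

theorem msg_of_niceAt {r : Run S} {w : ℕ} {i : P} (j : P)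
    (h : (alarmProtocol S G proc t m₀ hG).NiceAt proc r w i)
    [Decidable (((i, w), (j, w + 1)) ∈ G.actual)] :
    (alarmProtocol S G proc t m₀ hG).msg i
      ((alarmProtocol S G proc t m₀ hG).state proc r w i) j =
      if ((i, w), (j, w + 1)) ∈ G.actual then some m₀ else none := by
  rw [h, state_niceRun_alarmProtocol]
  simp [alarmProtocol, niceState]

theorem msg_of_not_niceAt {r : Run S} {w : ℕ} {i : P} (j : P)
    (h : ¬ (alarmProtocol S G proc t m₀ hG).NiceAt proc r w i)
    [Decidable (((i, w), (j, w + 1)) ∈ G.null)] :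
    (alarmProtocol S G proc t m₀ hG).msg i
      ((alarmProtocol S G proc t m₀ hG).state proc r w i) j =
      if ((i, w), (j, w + 1)) ∈ G.null then some m₀ else none := by
  rw [Protocol.NiceAt, state_niceRun_alarmProtocol] at h
  have ht : ((alarmProtocol S G proc t m₀ hG).state proc r w i).time = w :=
    Protocol.state_time w i
  generalize (alarmProtocol S G proc t m₀ hG).state proc r w i = σ at h ht
  subst ht
  simp [alarmProtocol, h]

theorem sendsActual_niceRun_alarmProtocol {w : ℕ} {i j : P} :
    (alarmProtocol S G proc t m₀ hG).SendsActual proc (niceRun S) w i j ↔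
      ((i, w), (j, w + 1)) ∈ G.actual := by
  classical
  rw [Protocol.SendsActual]
  simp only [Protocol.sentFrom_of_active (active_niceRun i w)]
  rw [msg_of_niceAt j rfl]
  split_ifs with h <;> simp [h]

theorem performs_alarmProtocol_iff {r : Run S} {h : Fin k} {m : ℕ} :
    (alarmProtocol S G proc t m₀ hG).Performs proc r h m ↔
      m = t h ∧ r.Active (proc h) (t h) ∧
        (alarmProtocol S G proc t m₀ hG).NiceAt proc r (t h) (proc h) := by
  have key : (alarmProtocol S G proc t m₀ hG).Performs proc r h m → m = t h := by
    rintro ⟨-, e⟩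
    have := congrArg LocalState.time e
    rwa [Protocol.state_time] at this
  constructor
  · intro hp
    obtain rfl := key hp
    exact ⟨rfl, hp.1, hp.2.trans (state_niceRun_alarmProtocol _ _).symm⟩
  · rintro ⟨rfl, h1, h2⟩
    exact ⟨h1, h2.trans (state_niceRun_alarmProtocol _ _)⟩

/-- Without null messages from faulty processes, a state that is not nice is noticed along every
path of the graph. -/
theorem not_niceAt_of_reflTransGen {Q₀ : Protocol S M k} (hQ₀ : Q₀.niceGraph proc = G)
    {r : Run S} {B : Finset P} (hB : ∀ p ∉ B, r.fails p = none) {p q : P} {w v : ℕ}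
    (hpath : ReflTransGen (G.FreeEdge B) (p, w) (q, v))
    (hp : ¬ (alarmProtocol S G proc t m₀ hG).NiceAt proc r w p) :
    ¬ (alarmProtocol S G proc t m₀ hG).NiceAt proc r v q := by
  classical
  suffices ∀ a : P × ℕ, ReflTransGen (G.FreeEdge B) (p, w) a →
      ¬ (alarmProtocol S G proc t m₀ hG).NiceAt proc r a.2 a.1 from this _ hpath
  intro a ha
  induction ha with
  | refl => exact hp
  | @tail c d _ hcd ih =>
    obtain ⟨x, w⟩ := c
    obtain ⟨he, hfree⟩ := hcd
    have hdisj : ∀ {y}, ((x, w), (y, w + 1)) ∈ G.actual → ((x, w), (y, w + 1)) ∉ G.null := by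
      subst hQ₀
      exact fun h1 h2 =>
        (Protocol.niceGraph_null_iff.1 h2).1 (Protocol.niceGraph_actual_iff.1 h1)
    have hform : ∀ {d}, ((x, w), d) ∈ G.actual ∨ ((x, w), d) ∈ G.null → ∃ y, d = (y, w + 1) := by
      subst hQ₀
      rintro d (⟨i, j, u, e, -⟩ | ⟨i, j, u, e, -⟩) <;>
      · simp only [Prod.mk.injEq] at e
        obtain ⟨⟨-, rfl⟩, rfl⟩ := e
        exact ⟨j, rfl⟩
    rcases he with rfl | ha | hn
    · exact fun e => ih (Protocol.niceAt_succ_iff.1 e).1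
    -- Actual edge: a state that is not nice prescribes messages on null edges only, and a crash
    -- only suppresses messages, so the expected message is missing even if the sender is faulty.
    · obtain ⟨y, rfl⟩ := hform (Or.inl ha)
      intro e
      have e1 := (Protocol.niceAt_succ_iff.1 e).2.2 x
      rw [Protocol.sentFrom_of_active (active_niceRun x w), msg_of_niceAt y rfl, if_pos ha] at e1
      rcases Protocol.sentFrom_eq_none_or (Q := alarmProtocol S G proc t m₀ hG) r w x
        ((alarmProtocol S G proc t m₀ hG).state proc r w x) y with h | h
      · simp [h] at e1
      · rw [h, msg_of_not_niceAt y ih, if_neg (hdisj ha)] at e1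
        cases e1
    -- Null edge: its sender is outside `B`, hence never fails, and its alarm arrives where the nice
    -- run has silence.
    · obtain ⟨y, rfl⟩ := hform (Or.inr hn)
      intro e
      have e1 := (Protocol.niceAt_succ_iff.1 e).2.2 x
      have hact : r.Active x w := by simp [Run.Active, hB x (hfree hn)]
      rw [Protocol.sentFrom_of_active (active_niceRun x w), msg_of_niceAt y rfl,
        if_neg (fun h => hdisj h hn), Protocol.sentFrom_of_active hact,
        msg_of_not_niceAt y ih, if_pos hn] at e1
      cases e1

/-! ### Recovering the communication graph. -/

/-- The run in which the source has the value `0` and nobody fails. -/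
def zeroRun (S : Model P) : Run S where
  vs := false
  fails := fun _ => none
  card_le := by simp

/-- The run with `v_s = 1` in which only `b` fails, crashing at time `u` without sending. -/
def crashRun (S : Model P) (b : P) (u : ℕ) (hf : 1 ≤ S.f) : Run S where
  vs := true
  fails := fun p => if p = b then some (u, Finset.univ) else none
  card_le := by
    refine le_trans (Finset.card_le_card (t := {b}) ?_) (by simpa using hf)
    intro p
    by_cases h : p = b <;> simp [h]

theorem Run.one_le_f {r : Run S} {b : P} {w : ℕ} (h : r.CrashedBefore b w) : 1 ≤ S.f := by
  obtain ⟨τ, Bl, h, -⟩ := h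
  refine le_trans ?_ r.card_le
  rw [Nat.one_le_iff_ne_zero, ← Nat.pos_iff_ne_zero, Finset.card_pos]
  exact ⟨b, by simp [h]⟩

/-- Every null edge is used by the protocol in some run. -/
theorem exists_sendsActual_of_null {Q₀ : Protocol S M k} (hQ₀ : Q₀.niceGraph proc = G)
    {i j : P} {w : ℕ} (hn : ((i, w), (j, w + 1)) ∈ G.null) :
    ∃ r, (alarmProtocol S G proc t m₀ hG).SendsActual proc r w i j := by
  classical
  suffices ∃ r : Run S, r.Active i w ∧
      ¬ (alarmProtocol S G proc t m₀ hG).NiceAt proc r w i by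
    obtain ⟨r, h1, h2⟩ := this
    exact ⟨r, m₀, by rw [Protocol.sentFrom_of_active h1, msg_of_not_niceAt j h2, if_pos hn]⟩
  have hn' := hn
  rw [← hQ₀] at hn'
  obtain ⟨hns, r, m, hm⟩ := Protocol.niceGraph_null_iff.1 hn'
  have hic : ¬ r.CrashedBefore i w := fun h => by
    rw [Protocol.sentFrom_of_crashedBefore h] at hm; cases hm
  -- In a nice state `i` would be as silent towards `j` as in the nice run of `Q₀`.
  have hin : ¬ Q₀.NiceAt proc r w i := fun e => by
    refine hns ⟨m, ?_⟩
    rw [Protocol.sentFrom_of_active (active_niceRun i w), ← e, ← hm]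
    rcases Q₀.sentFrom_eq_none_or r w i (Q₀.state proc r w i) j with h | h
    · rw [h] at hm; cases hm
    · exact h.symm
  -- The path found for `Q₀` lives in `G` alone, so it also transmits deviations of the new
  -- protocol, in a run with a single cause.
  rcases Protocol.exists_path_of_not_niceAt hin hic with ⟨-, h⟩ | ⟨b, u, hb, hu, p, ha, h⟩
  · rw [hQ₀] at h
    refine ⟨zeroRun S, by simp [Run.Active, zeroRun],
      not_niceAt_of_reflTransGen hQ₀ (by simp [zeroRun]) h fun e => ?_⟩
    have := congrArg LocalState.initVal e
    simp [Protocol.state, zeroRun, niceRun] at this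
  · rw [hQ₀] at h ha
    have hib : i ≠ b := by
      rintro rfl
      obtain ⟨τ, Bl, h1, h2⟩ := hb
      exact hic ⟨τ, Bl, h1, by omega⟩
    refine ⟨crashRun S b u (Run.one_le_f hb), by simp [Run.Active, crashRun, hib],
      not_niceAt_of_reflTransGen (B := {b}) hQ₀ (fun p hp => ?_) h fun e => ?_⟩
    · have : p ≠ b := by simpa using hp
      simp [crashRun, this]
    · have e1 := (Protocol.niceAt_succ_iff.1 e).2.2 b
      rw [Protocol.sentFrom_of_active (active_niceRun b u), msg_of_niceAt p rfl, if_pos ha] at e1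
      simp [Protocol.sentFrom, crashRun] at e1

theorem niceGraph_alarmProtocol {Q₀ : Protocol S M k} (hQ₀ : Q₀.niceGraph proc = G) :
    (alarmProtocol S G proc t m₀ hG).niceGraph proc = G := by
  classical
  have hform : ∀ e, e ∈ G.actual ∨ e ∈ G.null → ∃ i j w, e = ((i, w), (j, w + 1)) := by
    subst hQ₀
    rintro e (⟨i, j, u, e, -⟩ | ⟨i, j, u, e, -⟩) <;> exact ⟨i, j, u, e⟩
  ext e
  · constructor
    · rintro ⟨i, j, w, rfl, h⟩
      exact sendsActual_niceRun_alarmProtocol.1 h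
    · intro h
      obtain ⟨i, j, w, rfl⟩ := hform e (Or.inl h)
      exact ⟨i, j, w, rfl, sendsActual_niceRun_alarmProtocol.2 h⟩
  · constructor
    · rintro ⟨i, j, w, rfl, -, h1, r, m, hm⟩
      rw [sendsActual_niceRun_alarmProtocol] at h1
      rcases Protocol.sentFrom_eq_none_or (Q := alarmProtocol S G proc t m₀ hG) r w i
        ((alarmProtocol S G proc t m₀ hG).state proc r w i) j with h | h
      · rw [h] at hm; cases hm
      · rw [h] at hm
        by_cases hN : (alarmProtocol S G proc t m₀ hG).NiceAt proc r w i
        · rw [msg_of_niceAt j hN, if_neg h1] at hm; cases hm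
        · rw [msg_of_not_niceAt j hN] at hm
          by_contra h2
          rw [if_neg h2] at hm; cases hm
    · intro h
      obtain ⟨i, j, w, rfl⟩ := hform e (Or.inr h)
      refine Protocol.niceGraph_null_iff.2 ⟨?_, exists_sendsActual_of_null hQ₀ h⟩
      rw [sendsActual_niceRun_alarmProtocol]
      subst hQ₀
      exact fun h1 => (Protocol.niceGraph_null_iff.1 h).1 (Protocol.niceGraph_actual_iff.1 h1)

/-! ### What resilient blocks guarantee. -/

/-- The set of the processes that fail in `r`. -/
def Run.faulty (r : Run S) : Finset P :=
  Finset.univ.filter fun p => (r.fails p).isSome = true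

theorem Run.fails_of_notMem_faulty {r : Run S} {p : P} (h : p ∉ r.faulty) :
    r.fails p = none := by
  simpa [Run.faulty] using h

theorem Run.CrashedBefore.mem_faulty {r : Run S} {p : P} {w : ℕ} (h : r.CrashedBefore p w) :
    p ∈ r.faulty := by
  obtain ⟨τ, Bl, h, -⟩ := h
  simp [Run.faulty, h]

/-- A node with an `f`-resilient block from the source is not nice if `v_s = 0`. -/
theorem vs_eq_true_of_niceAt {Q₀ : Protocol S M k} (hQ₀ : Q₀.niceGraph proc = G) {r : Run S} {i : P} {w : ℕ}
    (hblock : ∃ Γ, G.IsResilientBlock (S.f : ℤ) (S.source, 0) (i, w) Γ)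
    (hN : (alarmProtocol S G proc t m₀ hG).NiceAt proc r w i) : r.vs = true := by
  by_contra hv
  obtain ⟨Γ, hΓ, hB⟩ := hblock
  obtain ⟨π, hπ, hfree⟩ := hB r.faulty (by exact_mod_cast r.card_le)
  refine not_niceAt_of_reflTransGen hQ₀ (fun p => Run.fails_of_notMem_faulty)
    (CommGraph.reflTransGen_of_isPath (hΓ π hπ) hfree) (fun e => ?_) hN
  have := congrArg LocalState.initVal e
  simp [Protocol.state, niceRun, hv] at this

/-- With an `(f - 1)`-resilient block without null messages from `i`, a crash of `i` is noticed. -/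
theorem active_of_niceAt {Q₀ : Protocol S M k} (hQ₀ : Q₀.niceGraph proc = G) {r : Run S} {i j : P} {u w : ℕ}
    (hblock : ∃ Γ, G.IsResilientBlock ((S.f : ℤ) - 1) (i, u + 1) (j, w) Γ ∧
      ∀ π ∈ Γ, G.NullFree {i} π)
    (hN : (alarmProtocol S G proc t m₀ hG).NiceAt proc r w j) : r.Active i u := by
  by_contra hc
  rw [Run.not_active_iff] at hc
  obtain ⟨Γ, ⟨hΓ, hB⟩, hi⟩ := hblock
  -- As `i` is faulty, at most `f - 1` others are; null messages from `i` itself are excluded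
  -- separately.
  have hcard := Finset.card_erase_add_one hc.mem_faulty
  have hle : r.faulty.card ≤ S.f := r.card_le
  obtain ⟨π, hπ, hfree⟩ := hB (r.faulty.erase i) (by omega)
  refine not_niceAt_of_reflTransGen (B := r.faulty) hQ₀ (fun p => Run.fails_of_notMem_faulty)
    (CommGraph.reflTransGen_of_isPath (hΓ π hπ) fun e he hn hf => ?_)
    (Protocol.not_niceAt_of_crashedBefore hc) hN
  refine hfree e he hn (Finset.mem_erase.2 ⟨fun h => ?_, hf⟩)
  exact hi π hπ e he hn (by simp [h])

end Construction

end OrderedResponse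

/-! ### Ordered Response from the three conditions. -/

theorem mainTheorem9 {P M : Type*} [Fintype P] [DecidableEq P] [Nontrivial M]
    (S : OrderedResponse.Model P) {k : ℕ} (proc : Fin k → P)
    (t : Fin k → ℕ) (ht : Monotone t)
    (CG : OrderedResponse.CommGraph P)
    (hCG : ∃ Q₀ : OrderedResponse.Protocol S M k, Q₀.niceGraph proc = CG)
    (h_source : ∀ h : Fin k,
      ∃ Γ, CG.IsResilientBlock (S.f : ℤ) (S.source, 0) (proc h, t h) Γ)
    (h_consec : ∀ h h' : Fin k, (h' : ℕ) = (h : ℕ) + 1 →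
      ∃ Γ, CG.IsResilientBlock ((S.f : ℤ) - 1) (proc h, t h + 1) (proc h', t h') Γ ∧
        ∀ π ∈ Γ, CG.NullFree {proc h} π)
    (h_path : ∀ (b : P) (mb : ℕ) (x h : Fin k) (B : Finset P), x < h →
      (∃ (ρq : P × ℕ) (l : List (P × ℕ)),
        CG.IsPath (b, mb) (proc x, t x) ((b, mb) :: ρq :: l) ∧
        ((b, mb), ρq) ∈ CG.actual ∧
        CG.NullFree {b} ((b, mb) :: ρq :: l)) →
      b ∈ B → B.card ≤ S.f →
      ¬ CG.HasNullFreePath B (proc x, t x) (proc h, t h) →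
      CG.HasNullFreePath B (b, mb + 1) (proc h, t h)) :
    ∃ Q : OrderedResponse.Protocol S M k,
      Q.niceGraph proc = CG ∧ Q.SolvesAt proc t ∧ Q.Conservative proc t := by
  classical
  obtain ⟨Q₀, hQ₀⟩ := hCG
  obtain ⟨m₀⟩ : Nonempty M := inferInstance
  have hG : ∀ {i j : P} {w : ℕ}, ((i, w), (j, w + 1)) ∈ CG.actual ∨
      ((i, w), (j, w + 1)) ∈ CG.null → S.chan i j := by
    subst hQ₀
    exact fun h => OrderedResponse.Protocol.chan_of_mem_niceGraph h
  have hNG : (OrderedResponse.alarmProtocol S CG proc t m₀ hG).niceGraph proc = CG :=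
    OrderedResponse.niceGraph_alarmProtocol hQ₀
  refine ⟨OrderedResponse.alarmProtocol S CG proc t m₀ hG, hNG, ⟨?_, ?_⟩, ?_⟩
  · intro r h m hp
    obtain ⟨rfl, hact, hN⟩ := OrderedResponse.performs_alarmProtocol_iff.1 hp
    have hv := OrderedResponse.vs_eq_true_of_niceAt hQ₀ (h_source h) hN
    refine ⟨hv, fun j hj => ⟨⟨t j, ?_⟩, fun m' hm' => ?_⟩⟩
    -- Induction on the distance below `h`: each step deduces `a_j` from `a_{j+1}`.
    · obtain ⟨d, hd⟩ : ∃ d, (h : ℕ) = j + d := ⟨h - j, by have : (j : ℕ) < h := hj; omega⟩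
      clear hj
      induction d generalizing j with
      | zero =>
        obtain rfl : h = j := Fin.ext hd
        exact hp
      | succ d ih =>
        have hlt : (j : ℕ) + 1 < k := by have := h.2; omega
        have hjx : j < ⟨j + 1, hlt⟩ := Fin.lt_def.2 (Nat.lt_succ_self _)
        obtain ⟨-, -, hN'⟩ := OrderedResponse.performs_alarmProtocol_iff.1
          (ih ⟨j + 1, hlt⟩ (by simp only; omega))
        have hja := OrderedResponse.active_of_niceAt hQ₀ (h_consec j ⟨j + 1, hlt⟩ rfl) hN'
        refine OrderedResponse.performs_alarmProtocol_iff.2 ⟨rfl, hja, ?_⟩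
        by_contra hjn
        have hjc : ¬ r.CrashedBefore (proc j) (t j) := by
          rintro ⟨τ, Bl, h1, h2⟩
          have := hja τ Bl h1
          omega
        have hB : ∀ p ∉ r.faulty, r.fails p = none :=
          fun p => OrderedResponse.Run.fails_of_notMem_faulty
        rcases OrderedResponse.Protocol.exists_path_of_not_niceAt hjn hjc with
          ⟨h1, -⟩ | ⟨b, u, hb, -, p, ha, hpath⟩
        · rw [hv] at h1; cases h1
        · rw [hNG] at ha hpath
          obtain ⟨l, ⟨-, hl2, hl3⟩, hl4⟩ := OrderedResponse.CommGraph.exists_isPath_cons hpath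
          have hfree : CG.FreeEdge {b} (b, u) (p, u + 1) := by
            rw [← hNG] at ha ⊢
            exact OrderedResponse.Protocol.freeEdge_of_actual _ ha
          -- A null-free path from the deviating node of `a_j` would already contradict niceness at
          -- `a_{j+1}`, so condition 3 supplies one from `(b, u + 1)`, where the crash of `b` shows.
          have key := h_path b u j ⟨j + 1, hlt⟩ r.faulty hjx
            ⟨(p, u + 1), l, ⟨rfl, by simpa using hl2, List.isChain_cons_cons.2 ⟨hfree.1, hl3⟩⟩, ha,
              OrderedResponse.CommGraph.nullFree_cons_cons.2 ⟨hfree.2, hl4⟩⟩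
            hb.mem_faulty r.card_le
            (fun hx => OrderedResponse.not_niceAt_of_reflTransGen hQ₀ hB
              (OrderedResponse.CommGraph.hasNullFreePath_iff.1 hx) hjn hN')
          exact OrderedResponse.not_niceAt_of_reflTransGen hQ₀ hB
            (OrderedResponse.CommGraph.hasNullFreePath_iff.1 key)
            (OrderedResponse.Protocol.not_niceAt_of_crashedBefore hb) hN'
    · obtain ⟨rfl, -⟩ := OrderedResponse.performs_alarmProtocol_iff.1 hm'
      exact ht hj.le
  · intro h m
    rw [OrderedResponse.performs_alarmProtocol_iff]
    exact ⟨fun e => e.1, fun e => ⟨e, OrderedResponse.active_niceRun _ _, rfl⟩⟩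
  · intro r h hp hK
    obtain ⟨-, -, hN⟩ := OrderedResponse.performs_alarmProtocol_iff.1 hp
    -- Acting requires a nice state, so the nice run is always among the runs considered possible.
    exact hK (OrderedResponse.niceRun S) hN.symm rfl
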